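/- Let $G$ be a connected complex semisimple Lie group with Lie algebra $\mathfrak g$, and let $Z$ be a flag manifold of $G$, i.e. a (compact) projective algebraic complex manifold with a transitive holomorphic $G$-action. Let $\mathfrak g_0=\mathrm{Fix}(\tau)$ be a real form of $\mathfrak g$, where $\tau:\mathfrak g\to\mathfrak g$ is an antilinear involutive Lie algebra automorphism, let $G_0\subset G$ be the subgroup generated by $\exp(\mathfrak g_0)$, and let $K_0$ be a maximal compact subgroup of $G_0$. A flag domain is an open $G_0$-orbit $D\subset Z$; the base cycle $C_0\subset D$ is the $K_0$-orbit in $D$ which is a complex submanifold of $Z$; and a cycle is a translate $C=g(C_0)\subset Z$ with $g\in G$ (for any choice of $K_0$ and $D$). Let $E=TZ|_C/TC$ be the holomorphic normal bundle of $C$ in $Z$. For $\xi\in\mathfrak g$ let $\hat\xi$ be the induced vector field on $Z$, $\hat\xi(z)=d(g\mapsto g\cdot z)_{1}(\xi)$. Then for every cycle $C$: 1. $E$ is spanned: for every $p\in C$ there are global holomorphic sections $s_1,\dots,s_r\in\Gamma(C,E)$ such that $s_1(p),\dots,s_r(p)$ is a basis of the fibre $E_p=T_pZ/T_pC$. 2.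 For every $\xi\in\mathfrak g$ the vector field $\hat\xi$ is holomorphic on $Z$, and $p\mapsto \hat\xi(p)+T_pC$ is a global holomorphic section of $E$. 3. The sections in 1 can be chosen of this form: for every $p\in C$ there are $\xi_1,\dots,\xi_r\in\mathfrak g$ such that the classes of $\hat\xi_1(p),\dots,\hat\xi_r(p)$ form a basis of $T_pZ/T_pC$. -/

import Mathlib

open scoped Manifold ContDiff Pointwise LinearAlgebra.Projectivization Topology

noncomputable section

/-! ### Complex submanifolds and their normal bundles

Throughout, a complex manifold is a manifold of class `ω` modelled on a finite-dimensional complex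
normed space `E`, and "holomorphic" is `ContMDiff ... ω` over `ℂ`. -/

section NormalBundle

variable {E : Type*} [NormedAddCommGroup E] [NormedSpace ℂ E]
  {Z : Type*} [TopologicalSpace Z] [ChartedSpace E Z]

/-- `C` is an (embedded) complex submanifold of `Z`: around each of its points there is a
holomorphic chart of `Z` that straightens `C` to a complex linear subspace. -/
def IsComplexSubmanifold (E : Type*) [NormedAddCommGroup E] [NormedSpace ℂ E]
    {Z : Type*} [TopologicalSpace Z] [ChartedSpace E Z] (C : Set Z) : Prop :=
  ∀ p ∈ C, ∃ φ ∈ IsManifold.maximalAtlas 𝓘(ℂ, E) ω Z, p ∈ φ.source ∧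
    ∃ F : Submodule ℂ E, φ '' (φ.source ∩ C) = φ.target ∩ (F : Set E)

/-- The tangent space `T_p C` inside `T_p Z`: the span of the velocities at `p` of germs of
holomorphic curves in `Z` which pass through `p` and stay in `C`. (For a complex submanifold these
velocities already form a linear subspace.) The equality in the tangent bundle says that
`γ 0 = p` and `γ'(0) = v`. -/
def tangentSubspace (E : Type*) [NormedAddCommGroup E] [NormedSpace ℂ E]
    {Z : Type*} [TopologicalSpace Z] [ChartedSpace E Z] (C : Set Z) (p : Z) :
    Submodule ℂ (TangentSpace 𝓘(ℂ, E) p) :=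
  Submodule.span ℂ {v | ∃ γ : ℂ → Z, ContMDiffAt 𝓘(ℂ, ℂ) 𝓘(ℂ, E) ω γ 0 ∧ (∀ᶠ t in 𝓝 0, γ t ∈ C) ∧
    (⟨γ 0, mfderiv 𝓘(ℂ, ℂ) 𝓘(ℂ, E) γ 0 (1 : ℂ)⟩ : TangentBundle 𝓘(ℂ, E) Z) = ⟨p, v⟩}

/-- The fibre `N_p = T_p Z / T_p C` of the normal bundle of `C` in `Z`. -/
abbrev NormalFiber (E : Type*) [NormedAddCommGroup E] [NormedSpace ℂ E]
    {Z : Type*} [TopologicalSpace Z] [ChartedSpace E Z] (C : Set Z) (p : C) : Type _ :=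
  TangentSpace 𝓘(ℂ, E) (p : Z) ⧸ tangentSubspace E C (p : Z)

/-- The normal bundle is the quotient of `TZ|_C` by `TC`, so a section of it is holomorphic iff
it can be lifted, near each point of `C`, to a holomorphic section of `TZ|_C`; equivalently (`C`
being a submanifold), to a holomorphic vector field on an open subset of `Z`. -/
def IsHolomorphicNormalSection {C : Set Z} [IsManifold 𝓘(ℂ, E) ω Z]
    (s : ∀ p : C, NormalFiber E C p) : Prop :=
  ∀ p : C, ∃ U : Set Z, IsOpen U ∧ (p : Z) ∈ U ∧ ∃ X : ∀ z : Z, TangentSpace 𝓘(ℂ, E) z,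
    ContMDiffOn 𝓘(ℂ, E) 𝓘(ℂ, E).tangent ω
      (fun z ↦ (⟨z, X z⟩ : TangentBundle 𝓘(ℂ, E) Z)) U ∧
    ∀ q : C, (q : Z) ∈ U → s q = Submodule.Quotient.mk (X q)

/-- The complex vector space `Γ(C, N)` of global holomorphic sections of the normal bundle. -/
def normalSections (E : Type*) [NormedAddCommGroup E] [NormedSpace ℂ E]
    {Z : Type*} [TopologicalSpace Z] [ChartedSpace E Z] [IsManifold 𝓘(ℂ, E) ω Z] (C : Set Z) :
    Submodule ℂ (∀ p : C, NormalFiber E C p) where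
  carrier := {s | IsHolomorphicNormalSection s}
  zero_mem' := fun _ ↦ ⟨Set.univ, isOpen_univ, Set.mem_univ _, fun _ ↦ 0,
    (Bundle.contMDiff_zeroSection ℂ (TangentSpace 𝓘(ℂ, E) (M := Z))).contMDiffOn,
    fun _ _ ↦ rfl⟩
  add_mem' := by
    intro s t hs ht p
    obtain ⟨U, hU, hpU, X, hX, hsX⟩ := hs p
    obtain ⟨V, hV, hpV, Y, hY, htY⟩ := ht p
    refine ⟨U ∩ V, hU.inter hV, ⟨hpU, hpV⟩, X + Y,
      (hX.mono Set.inter_subset_left).add_section (hY.mono Set.inter_subset_right), ?_⟩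
    intro q hq
    simp only [Pi.add_apply]
    rw [hsX q hq.1, htY q hq.2]
    rfl
  smul_mem' := by
    intro c s hs p
    obtain ⟨U, hU, hpU, X, hX, hsX⟩ := hs p
    refine ⟨U, hU, hpU, c • X, hX.const_smul_section, ?_⟩
    intro q hq
    simp only [Pi.smul_apply]
    rw [hsX q hq]
    rfl

end NormalBundle

/-- A vector bundle with fibres `N x` and space of global holomorphic sections `Γ` is spanned:
for every `x` there are global sections whose values at `x` form a basis of the fibre. -/
def IsSpannedBy {X : Type*} {N : X → Type*} [∀ x, AddCommGroup (N x)] [∀ x, Module ℂ (N x)]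
    (Γ : Submodule ℂ (∀ x, N x)) : Prop :=
  ∀ x, ∃ (r : ℕ) (s : Fin r → Γ) (b : Module.Basis (Fin r) ℂ (N x)),
    ∀ i, b i = (s i : ∀ x, N x) x

/-! ### Complex Lie groups, real forms and flag manifolds -/

section Group

/-- A real form of a complex Lie algebra, given by an antilinear involutive Lie algebra
automorphism; the real form itself is its fixed-point algebra. -/
structure RealForm (L : Type*) [LieRing L] [LieAlgebra ℂ L] where
  τ : L →ₛₗ[starRingEnd ℂ] L
  involutive : ∀ x, τ (τ x) = x
  map_lie : ∀ x y, τ ⁅x, y⁆ = ⁅τ x, τ y⁆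

/-- `g = exp ξ` in the complex Lie group `G`: `g` is the value at time `1` of the holomorphic
integral curve through `1` of the left-invariant vector field of `ξ`. -/
def IsExp {EG : Type*} [NormedAddCommGroup EG] [NormedSpace ℂ EG]
    {G : Type*} [TopologicalSpace G] [ChartedSpace EG G] [Group G]
    (ξ : GroupLieAlgebra 𝓘(ℂ, EG) G) (g : G) : Prop :=
  ∃ γ : ℂ → G, γ 0 = 1 ∧ γ 1 = g ∧
    ∀ t, HasMFDerivAt 𝓘(ℂ, ℂ) 𝓘(ℂ, EG) γ t
      (ContinuousLinearMap.toSpanSingleton ℂ (mulInvariantVectorField ξ (γ t)))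

variable {EG : Type*} [NormedAddCommGroup EG] [NormedSpace ℂ EG] [CompleteSpace EG]
  {G : Type*} [TopologicalSpace G] [ChartedSpace EG G] [Group G] [LieGroup 𝓘(ℂ, EG) ω G]

/-- The connected subgroup `G₀` of `G` with Lie algebra the real form `𝔤₀ = Fix τ`: the subgroup
generated by `exp 𝔤₀`. -/
def RealForm.group (σ : RealForm (GroupLieAlgebra 𝓘(ℂ, EG) G)) : Subgroup G :=
  Subgroup.closure {g | ∃ ξ : GroupLieAlgebra 𝓘(ℂ, EG) G, σ.τ ξ = ξ ∧ IsExp ξ g}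

/-- `K₀` is a maximal compact subgroup of `G₀`. -/
def IsMaximalCompactSubgroup {G : Type*} [TopologicalSpace G] [Group G] (G₀ K₀ : Subgroup G) :
    Prop :=
  Maximal (fun H : Subgroup G ↦ H ≤ G₀ ∧ IsCompact (H : Set G)) K₀

/-- `Z` admits a holomorphic embedding into a complex projective space. (For compact `Z` this means
that `Z` is projective algebraic.) The map `f` is locally given by nowhere vanishing holomorphic
homogeneous coordinates `F`; it is immersive when no nonzero tangent vector is sent by `dF` into
the line spanned by `F`. -/
def IsProjectiveManifold (E : Type*) [NormedAddCommGroup E] [NormedSpace ℂ E]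
    (Z : Type*) [TopologicalSpace Z] [ChartedSpace E Z] : Prop :=
  ∃ (N : ℕ) (f : Z → ℙ ℂ (Fin (N + 1) → ℂ)), Function.Injective f ∧
    ∀ z, ∃ U : Set Z, IsOpen U ∧ z ∈ U ∧ ∃ F : Z → (Fin (N + 1) → ℂ),
      ContMDiffOn 𝓘(ℂ, E) 𝓘(ℂ, Fin (N + 1) → ℂ) ω F U ∧
      ∀ x ∈ U, (∃ h : F x ≠ 0, f x = Projectivization.mk ℂ (F x) h) ∧
        ∀ v : TangentSpace 𝓘(ℂ, E) x,
          (mfderiv 𝓘(ℂ, E) 𝓘(ℂ, Fin (N + 1) → ℂ) F x v : Fin (N + 1) → ℂ) ∈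
            Submodule.span ℂ {F x} → v = 0

/-- The complex manifold `Z`, with the given `G`-action, is a flag manifold of `G`: a projective
algebraic homogeneous space of `G`. -/
structure IsFlagManifold (EG : Type*) [NormedAddCommGroup EG] [NormedSpace ℂ EG]
    (G : Type*) [TopologicalSpace G] [ChartedSpace EG G] [Group G]
    (E : Type*) [NormedAddCommGroup E] [NormedSpace ℂ E]
    (Z : Type*) [TopologicalSpace Z] [ChartedSpace E Z] [MulAction G Z] : Prop where
  nonempty : Nonempty Z
  compact : CompactSpace Z
  projective : IsProjectiveManifold E Z
  holomorphic : ContMDiffSMul 𝓘(ℂ, EG) 𝓘(ℂ, E) ω G Z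
  transitive : MulAction.IsPretransitive G Z

variable {Z : Type*} [TopologicalSpace Z] [MulAction G Z]

/-- A flag domain: an open orbit of the real form `G₀` in `Z`. -/
def IsFlagDomain (σ : RealForm (GroupLieAlgebra 𝓘(ℂ, EG) G)) (D : Set Z) : Prop :=
  IsOpen D ∧ ∃ z : Z, D = MulAction.orbit σ.group z

/-- `C₀` is the base cycle in `D` for `K₀`: the `K₀`-orbit in `D` which is a complex
submanifold. -/
def IsBaseCycle (E : Type*) [NormedAddCommGroup E] [NormedSpace ℂ E]
    {Z : Type*} [TopologicalSpace Z] [ChartedSpace E Z] {G : Type*} [Group G] [MulAction G Z]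
    (K₀ : Subgroup G) (D C₀ : Set Z) : Prop :=
  ∃ z ∈ D, C₀ = MulAction.orbit K₀ z ∧ IsComplexSubmanifold E C₀

/-- `C` is a cycle in the `G`-flag manifold `Z`, relative to the real form `σ`: a `G`-translate
of the base cycle in some flag domain, for some choice of the maximal compact subgroup. -/
def IsCycle (E : Type*) [NormedAddCommGroup E] [NormedSpace ℂ E]
    {Z : Type*} [TopologicalSpace Z] [ChartedSpace E Z] [MulAction G Z]
    (σ : RealForm (GroupLieAlgebra 𝓘(ℂ, EG) G)) (C : Set Z) : Prop :=
  ∃ (K₀ : Subgroup G) (D C₀ : Set Z) (g : G), IsMaximalCompactSubgroup σ.group K₀ ∧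
    IsFlagDomain σ D ∧ IsBaseCycle E K₀ D C₀ ∧ C = g • C₀

end Group

/-- The vector field `ξ̂` on `Z` induced by `ξ ∈ 𝔤`: its value at `z` is the derivative at `1` of the
orbit map `g ↦ g • z` applied to `ξ` (a tangent vector at `1 • z = z`). -/
def inducedVectorField {EG : Type*} [NormedAddCommGroup EG] [NormedSpace ℂ EG]
    {G : Type*} [TopologicalSpace G] [ChartedSpace EG G] [Group G]
    (E : Type*) [NormedAddCommGroup E] [NormedSpace ℂ E]
    {Z : Type*} [TopologicalSpace Z] [ChartedSpace E Z] [MulAction G Z]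
    (ξ : GroupLieAlgebra 𝓘(ℂ, EG) G) (z : Z) : TangentSpace 𝓘(ℂ, E) z :=
  mfderiv 𝓘(ℂ, EG) 𝓘(ℂ, E) (fun g : G ↦ g • z) (1 : G) ξ

/-- The section of the normal bundle of `C` induced by `ξ ∈ 𝔤`. -/
def inducedNormalSection {EG : Type*} [NormedAddCommGroup EG] [NormedSpace ℂ EG]
    {G : Type*} [TopologicalSpace G] [ChartedSpace EG G] [Group G]
    (E : Type*) [NormedAddCommGroup E] [NormedSpace ℂ E]
    {Z : Type*} [TopologicalSpace Z] [ChartedSpace E Z] [MulAction G Z] (C : Set Z)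
    (ξ : GroupLieAlgebra 𝓘(ℂ, EG) G) (p : C) : NormalFiber E C p :=
  Submodule.Quotient.mk (inducedVectorField E ξ (p : Z))

end

/-! The normal bundle is a quotient of `TZ|_C`, so it suffices that the induced fields are
holomorphic and that `𝔤 → T_z Z` is onto for every `z`. For the latter, the orbit map `g ↦ g • z` is
open by a Baire category argument, and by equivariance its rank is constant. An open map of constant
rank is a submersion: otherwise, near any point, its image would lie in a submanifold of positive
codimension. `ContDiffAt.range_fderiv_eq_top_of_nhds_le_map` is the local form of this, and
`inducedVectorField_surjective` applies it to orbit maps at `1`. -/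

/-! ### Open maps of maximal rank between vector spaces -/

/-- If a `C¹` map satisfies `P (B y) = y.1` and its derivative has rank at most the dimension of the
range of `P`, then its derivative vanishes in the directions of the second factor. -/
theorem fderiv_inr_eq_zero_of_finrank_le {𝕜 R K F : Type*} [RCLike 𝕜]
    [NormedAddCommGroup R] [NormedSpace 𝕜 R] [FiniteDimensional 𝕜 R]
    [NormedAddCommGroup K] [NormedSpace 𝕜 K]
    [NormedAddCommGroup F] [NormedSpace 𝕜 F] [FiniteDimensional 𝕜 F]
    {P : F →L[𝕜] R} {B : R × K →L[𝕜] F} (hPB : P ∘L B = ContinuousLinearMap.fst 𝕜 R K)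
    (hB : Module.finrank 𝕜 B.range ≤ Module.finrank 𝕜 R) (k : K) : B (0, k) = 0 := by
  let p : B.range →ₗ[𝕜] R := P.toLinearMap ∘ₗ B.range.subtype
  have happ (y : R × K) : P (B y) = y.1 := DFunLike.congr_fun hPB y
  have hsurj : Function.Surjective p := fun r ↦ ⟨⟨B (r, 0), ⟨(r, 0), rfl⟩⟩, happ _⟩
  have hfin : Module.finrank 𝕜 B.range = Module.finrank 𝕜 R :=
    le_antisymm hB (LinearMap.finrank_le_finrank_of_surjective hsurj)
  -- By the dimension count `P` is injective on the range of `B`, and it kills `B (0, k)`.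
  have hinj : Function.Injective p :=
    (LinearMap.injective_iff_surjective_of_finrank_eq_finrank hfin).2 hsurj
  have h0 : (⟨B (0, k), ⟨(0, k), rfl⟩⟩ : B.range) = 0 := by
    apply hinj
    rw [map_zero]
    exact happ _
  exact congrArg Subtype.val h0

/-- A `C¹` map of finite-dimensional spaces, open at `x₀`, whose derivative has maximal rank at
`x₀` among nearby points, is a submersion at `x₀`. -/
theorem ContDiffAt.range_fderiv_eq_top_of_nhds_le_map {𝕜 V F : Type*} [RCLike 𝕜]
    [NormedAddCommGroup V] [NormedSpace 𝕜 V] [FiniteDimensional 𝕜 V]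
    [NormedAddCommGroup F] [NormedSpace 𝕜 F] [FiniteDimensional 𝕜 F]
    {A : V → F} {x₀ : V} (hA : ContDiffAt 𝕜 1 A x₀)
    (hrank : ∀ᶠ x in 𝓝 x₀,
      Module.finrank 𝕜 (fderiv 𝕜 A x).range ≤ Module.finrank 𝕜 (fderiv 𝕜 A x₀).range)
    (hopen : 𝓝 (A x₀) ≤ Filter.map A (𝓝 x₀)) : (fderiv 𝕜 A x₀).range = ⊤ := by
  have : CompleteSpace V := FiniteDimensional.complete 𝕜 V
  set A' := fderiv 𝕜 A x₀ with hA'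
  obtain ⟨P, hP⟩ := Submodule.ClosedComplemented.of_finiteDimensional A'.range
  obtain ⟨Q, hQ⟩ := Submodule.ClosedComplemented.of_finiteDimensional A'.ker
  have hA0 : HasFDerivAt A A' x₀ := (hA.differentiableAt one_ne_zero).hasFDerivAt
  -- `T` is the derivative of `Ψ` at `x₀`. Once it is invertible, `Ψ` is a local coordinate system
  -- in which `P ∘ A` is the first projection.
  let T : V →L[𝕜] A'.range × A'.ker := (P ∘L A').prod Q
  have hTinj : Function.Injective T := by
    rw [injective_iff_map_eq_zero]
    intro v hv
    have h1 : P (A' v) = 0 := congrArg Prod.fst hv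
    have h2 : Q v = 0 := congrArg Prod.snd hv
    have h3 : A' v = 0 := by
      have := hP ⟨A' v, ⟨v, rfl⟩⟩
      rw [h1] at this
      exact (congrArg Subtype.val this).symm
    have h4 := hQ ⟨v, h3⟩
    rw [h2] at h4
    exact (congrArg Subtype.val h4).symm
  have hfin : Module.finrank 𝕜 V = Module.finrank 𝕜 (A'.range × A'.ker) := by
    rw [Module.finrank_prod]
    exact (LinearMap.finrank_range_add_finrank_ker A'.toLinearMap).symm
  let T' : V ≃L[𝕜] A'.range × A'.ker :=
    (LinearEquiv.ofInjectiveOfFinrankEq T.toLinearMap hTinj hfin).toContinuousLinearEquiv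
  have hT' : (T' : V →L[𝕜] A'.range × A'.ker) = T := by ext v <;> rfl
  let Ψ : V → A'.range × A'.ker := fun x ↦ (P (A x), Q x)
  have hΨ : ContDiffAt 𝕜 1 Ψ x₀ :=
    (P.contDiff.contDiffAt.comp x₀ hA).prodMk Q.contDiff.contDiffAt
  have hΨ' : HasFDerivAt Ψ (T' : V →L[𝕜] A'.range × A'.ker) x₀ := by
    rw [hT']
    exact (P.hasFDerivAt.comp x₀ hA0).prodMk Q.hasFDerivAt
  let Φ := hΨ.localInverse hΨ' one_ne_zero
  have hΦ : ContDiffAt 𝕜 1 Φ (Ψ x₀) := hΨ.to_localInverse hΨ' one_ne_zero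
  have hs := hΨ.hasStrictFDerivAt' hΨ' one_ne_zero
  have hΦ0 : Φ (Ψ x₀) = x₀ := hΨ.localInverse_apply_image hΨ' one_ne_zero
  have hleft : ∀ᶠ x in 𝓝 x₀, Φ (Ψ x) = x := hs.eventually_left_inverse
  have hright : ∀ᶠ y in 𝓝 (Ψ x₀), Ψ (Φ y) = y := hs.eventually_right_inverse
  have htend : Filter.Tendsto Φ (𝓝 (Ψ x₀)) (𝓝 x₀) := by
    simpa only [hΦ0] using hΦ.continuousAt.tendsto
  have hAd : ∀ᶠ x in 𝓝 x₀, DifferentiableAt 𝕜 A x :=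
    (hA.eventually (by simp)).mono fun x hx ↦ hx.differentiableAt one_ne_zero
  have hΦd : ∀ᶠ y in 𝓝 (Ψ x₀), DifferentiableAt 𝕜 Φ y :=
    (hΦ.eventually (by simp)).mono fun x hx ↦ hx.differentiableAt one_ne_zero
  have key : ∀ᶠ y in 𝓝 (Ψ x₀), DifferentiableAt 𝕜 (A ∘ Φ) y ∧
      ∀ k, fderiv 𝕜 (A ∘ Φ) y (0, k) = 0 := by
    filter_upwards [htend.eventually hAd, htend.eventually hrank, hΦd,
      hright.eventually_nhds] with y h1 h2 h3 h4
    have hcomp := h1.hasFDerivAt.comp y h3.hasFDerivAt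
    refine ⟨hcomp.differentiableAt, fderiv_inr_eq_zero_of_finrank_le (P := P) ?_ ?_⟩
    · have e1 : HasFDerivAt (fun y ↦ P ((A ∘ Φ) y)) (P ∘L fderiv 𝕜 (A ∘ Φ) y) y :=
        P.hasFDerivAt.comp y hcomp.differentiableAt.hasFDerivAt
      have e2 : HasFDerivAt (fun y ↦ P ((A ∘ Φ) y))
          (ContinuousLinearMap.fst 𝕜 A'.range A'.ker) y :=
        hasFDerivAt_fst.congr_of_eventuallyEq (h4.mono fun z hz ↦ congrArg Prod.fst hz)
      exact e1.unique e2
    · rw [hcomp.fderiv]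
      refine le_trans (Submodule.finrank_mono ?_) h2
      exact LinearMap.range_comp_le_range _ _
  obtain ⟨ε, hε, hball⟩ := Metric.eventually_nhds_iff_ball.1 key
  -- In these coordinates `A` does not vary along the kernel directions, so it is constant on the
  -- slice through `Ψ x₀`, a convex ball.
  have hconst : ∀ k ∈ Metric.ball (Ψ x₀).2 ε, A (Φ ((Ψ x₀).1, k)) = A x₀ := by
    have hd : ∀ k ∈ Metric.ball (Ψ x₀).2 ε,
        HasFDerivAt (fun k ↦ (A ∘ Φ) ((Ψ x₀).1, k)) (0 : A'.ker →L[𝕜] F) k := by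
      intro k hk
      have hm : ((Ψ x₀).1, k) ∈ Metric.ball (Ψ x₀) ε := by
        rw [Metric.mem_ball, Prod.dist_eq]
        simpa [hε] using hk
      have h := (hball _ hm).1.hasFDerivAt.comp k (hasFDerivAt_prodMk_right (𝕜 := 𝕜) (Ψ x₀).1 k)
      exact h.congr_fderiv (ContinuousLinearMap.ext fun v ↦ (hball _ hm).2 v)
    intro k hk
    let _ : NormedSpace ℝ A'.ker := NormedSpace.restrictScalars ℝ 𝕜 A'.ker
    have h := (convex_ball (Ψ x₀).2 ε).is_const_of_fderivWithin_eq_zero (𝕜 := 𝕜)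
      (fun k hk ↦ (hd k hk).differentiableAt.differentiableWithinAt)
      (fun k hk ↦ (hd k hk).hasFDerivWithinAt.fderivWithin
        (Metric.isOpen_ball.uniqueDiffWithinAt hk)) hk (Metric.mem_ball_self hε)
    have h' : (A ∘ Φ) (Ψ x₀) = A x₀ := congrArg A hΦ0
    exact h.trans h'
  have hfib : ∀ᶠ x in 𝓝 x₀, P (A x) = P (A x₀) → A x = A x₀ := by
    have hQt : ∀ᶠ x in 𝓝 x₀, Q x ∈ Metric.ball (Ψ x₀).2 ε :=
      Q.continuous.continuousAt.eventually_mem (Metric.ball_mem_nhds _ hε)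
    filter_upwards [hleft, hQt] with x hx hxQ hPx
    have hΨx : Ψ x = ((Ψ x₀).1, Q x) := Prod.ext hPx rfl
    rw [← hconst _ hxQ, ← hΨx, hx]
  -- Openness turns a statement about values of `A` near `x₀` into one about all points near `A x₀`.
  have hw : ∀ᶠ w in 𝓝 (A x₀), P w = P (A x₀) → w = A x₀ := hopen (Filter.eventually_map.2 hfib)
  -- For `v` in the kernel of `P`, the points `A x₀ + t • v` with small `t ≠ 0` must equal `A x₀`.
  -- Hence the projection `P` is injective and its image, the range of `A'`, is everything.
  have hPinj : ∀ v, P v = 0 → v = 0 := by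
    intro v hv
    have ht : Filter.Tendsto (fun t : 𝕜 ↦ A x₀ + t • v) (𝓝[≠] 0) (𝓝 (A x₀)) := by
      have : Continuous fun t : 𝕜 ↦ A x₀ + t • v := by fun_prop
      simpa using (this.tendsto 0).mono_left nhdsWithin_le_nhds
    obtain ⟨t, ht1, ht2⟩ := ((ht.eventually hw).and self_mem_nhdsWithin).exists
    have := ht1 (by simp [hv])
    simpa [show t ≠ 0 from ht2] using this
  rw [eq_top_iff]
  intro v _
  have h := hPinj (v - P v) (by rw [map_sub, hP, sub_self])
  rw [sub_eq_zero.1 h]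
  exact (P v).2

/-! ### Transfer to manifolds -/

theorem finrank_range_comp_comp_le {𝕜 V W W' V' : Type*} [RCLike 𝕜]
    [NormedAddCommGroup V] [NormedSpace 𝕜 V]
    [NormedAddCommGroup W] [NormedSpace 𝕜 W]
    [NormedAddCommGroup W'] [NormedSpace 𝕜 W'] [FiniteDimensional 𝕜 W']
    [NormedAddCommGroup V'] [NormedSpace 𝕜 V']
    (c : W' →L[𝕜] V') (b : W →L[𝕜] W') (a : V →L[𝕜] W) :
    Module.finrank 𝕜 (c.comp (b.comp a)).range ≤ Module.finrank 𝕜 b.range := by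
  have h : (c.comp (b.comp a)).range ≤ b.range.map c.toLinearMap := by
    rintro _ ⟨v, rfl⟩
    exact ⟨b (a v), ⟨a v, rfl⟩, rfl⟩
  exact (Submodule.finrank_mono h).trans (Submodule.finrank_map_le _ _)

/-- An open `C¹` map between manifolds is a submersion at every point where its derivative has
maximal rank. -/
theorem IsOpenMap.range_mfderiv_eq_top {𝕜 V F M N : Type*} [RCLike 𝕜]
    [NormedAddCommGroup V] [NormedSpace 𝕜 V] [FiniteDimensional 𝕜 V]
    [NormedAddCommGroup F] [NormedSpace 𝕜 F] [FiniteDimensional 𝕜 F]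
    [TopologicalSpace M] [ChartedSpace V M] [IsManifold 𝓘(𝕜, V) 1 M]
    [TopologicalSpace N] [ChartedSpace F N] [IsManifold 𝓘(𝕜, F) 1 N]
    {f : M → N} (hopen : IsOpenMap f) (hf : ContMDiff 𝓘(𝕜, V) 𝓘(𝕜, F) 1 f) (x : M)
    (hrank : ∀ y, Module.finrank 𝕜 (mfderiv 𝓘(𝕜, V) 𝓘(𝕜, F) f y).range ≤
      Module.finrank 𝕜 (mfderiv 𝓘(𝕜, V) 𝓘(𝕜, F) f x).range) :
    (mfderiv 𝓘(𝕜, V) 𝓘(𝕜, F) f x).range = ⊤ := by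
  have hfd : MDifferentiable 𝓘(𝕜, V) 𝓘(𝕜, F) f := hf.mdifferentiable one_ne_zero
  set φ := extChartAt 𝓘(𝕜, V) x with hφ
  set ψ := extChartAt 𝓘(𝕜, F) (f x) with hψ
  set A : V → F := writtenInExtChartAt 𝓘(𝕜, V) 𝓘(𝕜, F) x f with hA
  let D : V →L[𝕜] F := mfderiv 𝓘(𝕜, V) 𝓘(𝕜, F) f x
  have hD : HasFDerivAt A D (φ x) := by
    have h := (hfd x).hasMFDerivAt.2
    rw [modelWithCornersSelf_coe, Set.range_id] at h
    exact h.hasFDerivAt Filter.univ_mem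
  have hAc : ContDiffAt 𝕜 1 A (φ x) := by
    have h := (contMDiffAt_iff.1 (hf x)).2
    rw [modelWithCornersSelf_coe, Set.range_id] at h
    exact h.contDiffAt Filter.univ_mem
  have hφs : φ.symm (φ x) = x := extChartAt_to_inv x
  have hAx : A (φ x) = ψ (f x) := by
    change ψ (f (φ.symm (φ x))) = _
    rw [hφs]
  have hDr : (fderiv 𝕜 A (φ x)).range = D.range := by rw [hD.fderiv]
  refine Eq.trans (b := D.range) rfl (hDr.symm.trans ?_)
  refine ContDiffAt.range_fderiv_eq_top_of_nhds_le_map hAc ?_ ?_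
  -- By the chain rule the derivative of `A` at `v` factors through that of `f` at `φ.symm v`, which
  -- bounds its rank.
  · have htgt : ∀ᶠ v in 𝓝 (φ x), v ∈ φ.target := extChartAt_target_mem_nhds x
    have hcont : Filter.Tendsto (fun v ↦ f (φ.symm v)) (𝓝 (φ x)) (𝓝 (f x)) := by
      have h1 : Filter.Tendsto φ.symm (𝓝 (φ x)) (𝓝 x) := by
        simpa only [← hφ, hφs] using (continuousAt_extChartAt_symm (I := 𝓘(𝕜, V)) x).tendsto
      exact (hf.continuous.tendsto x).comp h1
    have hsrc : ∀ᶠ v in 𝓝 (φ x), f (φ.symm v) ∈ ψ.source :=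
      hcont.eventually_mem (extChartAt_source_mem_nhds (f x))
    filter_upwards [htgt, hsrc] with v hv1 hv2
    have d1 : MDifferentiableAt 𝓘(𝕜, V) 𝓘(𝕜, V) φ.symm v :=
      ((contMDiffOn_extChartAt_symm (n := 1) x).contMDiffAt
        ((isOpen_extChartAt_target x).mem_nhds hv1)).mdifferentiableAt one_ne_zero
    have d2 : MDifferentiableAt 𝓘(𝕜, F) 𝓘(𝕜, F) ψ (f (φ.symm v)) :=
      (contMDiffAt_extChartAt' (n := 1) (by simpa [hψ] using hv2)).mdifferentiableAt one_ne_zero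
    have d3 := (hfd (φ.symm v)).comp v d1
    have e : fderiv 𝕜 A v = (mfderiv 𝓘(𝕜, F) 𝓘(𝕜, F) ψ (f (φ.symm v))).comp
        ((mfderiv 𝓘(𝕜, V) 𝓘(𝕜, F) f (φ.symm v)).comp
          (mfderiv 𝓘(𝕜, V) 𝓘(𝕜, V) φ.symm v)) := by
      rw [← mfderiv_comp v (hfd _) d1, ← mfderiv_eq_fderiv]
      exact mfderiv_comp v d2 d3
    rw [hDr, e]
    exact (finrank_range_comp_comp_le (V := V) (W := V) (W' := F) (V' := F) _ _ _).trans
      (hrank (φ.symm v))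
  · rw [hAx, hψ, ← map_extChartAt_nhds_of_boundaryless]
    refine (Filter.map_mono (hopen.nhds_le x)).trans ?_
    rw [← map_extChartAt_nhds_of_boundaryless (I := 𝓘(𝕜, V)) x, Filter.map_map, Filter.map_map]
    refine le_of_eq (Filter.map_congr ?_)
    filter_upwards [extChartAt_source_mem_nhds (I := 𝓘(𝕜, V)) x] with y hy
    change ψ (f y) = ψ (f (φ.symm (φ y)))
    rw [φ.left_inv hy]

/-! ### Orbit maps and induced vector fields -/

section Action

variable {EG : Type*} [NormedAddCommGroup EG] [NormedSpace ℂ EG]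
  {G : Type*} [TopologicalSpace G] [ChartedSpace EG G] [Group G]
  {E : Type*} [NormedAddCommGroup E] [NormedSpace ℂ E]
  {Z : Type*} [TopologicalSpace Z] [ChartedSpace E Z] [MulAction G Z]

theorem contMDiff_orbitMap [ContMDiffSMul 𝓘(ℂ, EG) 𝓘(ℂ, E) ω G Z] (z : Z) :
    ContMDiff 𝓘(ℂ, EG) 𝓘(ℂ, E) ω (fun g : G ↦ g • z) :=
  contMDiff_id.smul (I := 𝓘(ℂ, EG)) contMDiff_const

/-- The orbit maps of a holomorphic action have constant rank. -/
theorem finrank_range_mfderiv_orbitMap_le [FiniteDimensional ℂ EG] [FiniteDimensional ℂ E]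
    [LieGroup 𝓘(ℂ, EG) ω G] [ContMDiffSMul 𝓘(ℂ, EG) 𝓘(ℂ, E) ω G Z] (z : Z) (g : G) :
    Module.finrank ℂ (mfderiv 𝓘(ℂ, EG) 𝓘(ℂ, E) (fun g : G ↦ g • z) g).range ≤
      Module.finrank ℂ (mfderiv 𝓘(ℂ, EG) 𝓘(ℂ, E) (fun g : G ↦ g • z) 1).range := by
  set f : G → Z := fun g ↦ g • z with hf
  have hω : (ω : ℕ∞ω) ≠ 0 := by simp
  have hfd : MDifferentiable 𝓘(ℂ, EG) 𝓘(ℂ, E) f := (contMDiff_orbitMap z).mdifferentiable hω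
  have hL : MDifferentiable 𝓘(ℂ, EG) 𝓘(ℂ, EG) (fun h : G ↦ g⁻¹ * h) :=
    (contMDiff_mul_left (I := 𝓘(ℂ, EG)) (n := ω)).mdifferentiable hω
  have hS : MDifferentiable 𝓘(ℂ, E) 𝓘(ℂ, E) (fun y : Z ↦ g • y) :=
    (ContMDiffSMul.contMDiff_const_smul (I := 𝓘(ℂ, EG)) (n := ω) g).mdifferentiable hω
  -- Equivariance `h • z = g • ((g⁻¹ * h) • z)` makes the derivative at `g` factor through the one
  -- at `1`.
  have hcomp : f = (fun y : Z ↦ g • y) ∘ (f ∘ fun h : G ↦ g⁻¹ * h) := by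
    ext h
    simp [hf, smul_smul]
  have e : mfderiv 𝓘(ℂ, EG) 𝓘(ℂ, E) f g =
      (mfderiv 𝓘(ℂ, E) 𝓘(ℂ, E) (fun y : Z ↦ g • y) (f (g⁻¹ * g))).comp
        ((mfderiv 𝓘(ℂ, EG) 𝓘(ℂ, E) f (g⁻¹ * g)).comp
          (mfderiv 𝓘(ℂ, EG) 𝓘(ℂ, EG) (fun h : G ↦ g⁻¹ * h) g)) := by
    rw [← mfderiv_comp g (hfd _) (hL g)]
    conv_lhs => rw [hcomp]
    exact mfderiv_comp g (hS _) ((hfd _).comp g (hL g))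
  rw [e, inv_mul_cancel]
  exact finrank_range_comp_comp_le (V := EG) (W := EG) (W' := E) (V' := E) _ _ _

/-- The vector fields induced by a transitive holomorphic action of a complex Lie group with
countable topology span every tangent space. -/
theorem inducedVectorField_surjective [FiniteDimensional ℂ EG] [FiniteDimensional ℂ E]
    [SecondCountableTopology G] [LieGroup 𝓘(ℂ, EG) ω G] [IsManifold 𝓘(ℂ, E) ω Z]
    [T2Space Z] [LocallyCompactSpace Z]
    [ContMDiffSMul 𝓘(ℂ, EG) 𝓘(ℂ, E) ω G Z] [MulAction.IsPretransitive G Z] (z : Z)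
    (v : TangentSpace 𝓘(ℂ, E) z) :
    ∃ ξ : GroupLieAlgebra 𝓘(ℂ, EG) G, inducedVectorField E ξ z = v := by
  have : IsTopologicalGroup G := topologicalGroup_of_lieGroup 𝓘(ℂ, EG) ω
  have : ContinuousSMul G Z := ContMDiffSMul.continuousSMul (I := 𝓘(ℂ, EG)) (I' := 𝓘(ℂ, E)) ω
  have : ProperSpace EG := FiniteDimensional.proper ℂ EG
  have : LocallyCompactSpace G := ChartedSpace.locallyCompactSpace EG G
  have : IsManifold 𝓘(ℂ, EG) 1 G := .of_le (n := ω) le_top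
  have : IsManifold 𝓘(ℂ, E) 1 Z := .of_le (n := ω) le_top
  -- `G` is σ-compact and `Z` is a Baire space, so the orbit map of the transitive action is open.
  have h := IsOpenMap.range_mfderiv_eq_top (isOpenMap_smul_of_sigmaCompact (G := G) z)
    ((contMDiff_orbitMap (EG := EG) (E := E) z).of_le le_top) 1
    (finrank_range_mfderiv_orbitMap_le z)
  exact LinearMap.range_eq_top.1 h v

/-- The field is the tangent map of the action `G × Z → Z` applied to the pair of `ξ` at `1` and the
zero vector at `z`. -/
theorem contMDiff_inducedVectorField [IsManifold 𝓘(ℂ, EG) ω G] [IsManifold 𝓘(ℂ, E) ω Z]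
    [ContMDiffSMul 𝓘(ℂ, EG) 𝓘(ℂ, E) ω G Z] (ξ : GroupLieAlgebra 𝓘(ℂ, EG) G) :
    ContMDiff 𝓘(ℂ, E) 𝓘(ℂ, E).tangent ω
      (fun z : Z ↦ (⟨z, inducedVectorField E ξ z⟩ : TangentBundle 𝓘(ℂ, E) Z)) := by
  have hact : ContMDiff (𝓘(ℂ, EG).prod 𝓘(ℂ, E)) 𝓘(ℂ, E) ω (fun p : G × Z ↦ p.1 • p.2) :=
    ContMDiffSMul.contMDiff_smul
  let F₁ : Z → TangentBundle 𝓘(ℂ, EG) G × TangentBundle 𝓘(ℂ, E) Z :=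
    fun z ↦ (⟨1, ξ⟩, ⟨z, 0⟩)
  have S₁ : ContMDiff 𝓘(ℂ, E) (𝓘(ℂ, EG).tangent.prod 𝓘(ℂ, E).tangent) ω F₁ :=
    contMDiff_const.prodMk (Bundle.contMDiff_zeroSection ℂ (TangentSpace 𝓘(ℂ, E) (M := Z)))
  have S₂ : ContMDiff (𝓘(ℂ, EG).tangent.prod 𝓘(ℂ, E).tangent) (𝓘(ℂ, EG).prod 𝓘(ℂ, E)).tangent ω
      (equivTangentBundleProd 𝓘(ℂ, EG) G 𝓘(ℂ, E) Z).symm := contMDiff_equivTangentBundleProd_symm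
  have S₃ : ContMDiff (𝓘(ℂ, EG).prod 𝓘(ℂ, E)).tangent 𝓘(ℂ, E).tangent ω
      (tangentMap (𝓘(ℂ, EG).prod 𝓘(ℂ, E)) 𝓘(ℂ, E) (fun p : G × Z ↦ p.1 • p.2)) :=
    hact.contMDiff_tangentMap (by simp)
  -- The tangent map lands over `1 • z`, which equals `z` only propositionally.
  have hone (z : Z) (u : E) :
      (⟨(1 : G) • z, u⟩ : TangentBundle 𝓘(ℂ, E) Z) = ⟨z, u⟩ := by rw [one_smul]
  refine ((S₃.comp S₂).comp S₁).congr fun z ↦ ?_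
  refine (hone z (inducedVectorField E ξ z)).symm.trans ?_
  have hd := mfderiv_prod_eq_add_apply (p := ((1 : G), z))
    (v := ((show EG from ξ), (0 : E))) (hact.mdifferentiableAt (by simp))
  have h0 : mfderiv 𝓘(ℂ, E) 𝓘(ℂ, E) (fun y : Z ↦ (1 : G) • y) z 0 = 0 := map_zero _
  have hd' := hd.trans ((congrArg (inducedVectorField E ξ z + ·) h0).trans (add_zero _))
  exact congrArg (fun u : E ↦ (⟨(1 : G) • z, u⟩ : TangentBundle 𝓘(ℂ, E) Z)) hd'.symm

end Action

/-! ### Spanning the normal bundle -/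

theorem exists_basis_eq_of_surjective {L N : Type*} [AddCommGroup N] [Module ℂ N]
    [FiniteDimensional ℂ N] (f : L → N) (hf : Function.Surjective f) :
    ∃ (r : ℕ) (ξ : Fin r → L) (b : Module.Basis (Fin r) ℂ N), ∀ i, b i = f (ξ i) :=
  ⟨_, fun i ↦ (hf (Module.finBasis ℂ N i)).choose, Module.finBasis ℂ N,
    fun i ↦ (hf (Module.finBasis ℂ N i)).choose_spec.symm⟩

theorem mainTheorem7
    {EG : Type*} [NormedAddCommGroup EG] [NormedSpace ℂ EG] [FiniteDimensional ℂ EG]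
    [CompleteSpace EG]
    {G : Type*} [TopologicalSpace G] [T2Space G] [SecondCountableTopology G] [ConnectedSpace G]
    [ChartedSpace EG G] [Group G] [LieGroup 𝓘(ℂ, EG) ω G]
    [LieAlgebra.IsSemisimple ℂ (GroupLieAlgebra 𝓘(ℂ, EG) G)]
    {E : Type*} [NormedAddCommGroup E] [NormedSpace ℂ E] [FiniteDimensional ℂ E]
    {Z : Type*} [TopologicalSpace Z] [T2Space Z] [ChartedSpace E Z] [IsManifold 𝓘(ℂ, E) ω Z]
    [MulAction G Z] (hZ : IsFlagManifold EG G E Z)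
    (σ : RealForm (GroupLieAlgebra 𝓘(ℂ, EG) G))
    (C : Set Z) (hC : IsCycle E σ C) :
    IsSpannedBy (normalSections E C) ∧
    (∀ ξ : GroupLieAlgebra 𝓘(ℂ, EG) G,
      ContMDiff 𝓘(ℂ, E) 𝓘(ℂ, E).tangent ω
        (fun z : Z ↦ (⟨z, inducedVectorField E ξ z⟩ : TangentBundle 𝓘(ℂ, E) Z)) ∧
      inducedNormalSection E C ξ ∈ normalSections E C) ∧
    ∀ p : C, ∃ (r : ℕ) (ξ : Fin r → GroupLieAlgebra 𝓘(ℂ, EG) G)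
      (b : Module.Basis (Fin r) ℂ (NormalFiber E C p)),
      ∀ i, b i = inducedNormalSection E C (ξ i) p := by
  have := hZ.compact
  have := hZ.holomorphic
  have := hZ.transitive
  have hsec (ξ : GroupLieAlgebra 𝓘(ℂ, EG) G) :
      ContMDiff 𝓘(ℂ, E) 𝓘(ℂ, E).tangent ω
        (fun z : Z ↦ (⟨z, inducedVectorField E ξ z⟩ : TangentBundle 𝓘(ℂ, E) Z)) ∧
      inducedNormalSection E C ξ ∈ normalSections E C :=
    ⟨contMDiff_inducedVectorField ξ, fun _ ↦ ⟨Set.univ, isOpen_univ, Set.mem_univ _,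
      inducedVectorField E ξ, (contMDiff_inducedVectorField ξ).contMDiffOn, fun _ _ ↦ rfl⟩⟩
  have hbasis (p : C) : ∃ (r : ℕ) (ξ : Fin r → GroupLieAlgebra 𝓘(ℂ, EG) G)
      (b : Module.Basis (Fin r) ℂ (NormalFiber E C p)),
      ∀ i, b i = inducedNormalSection E C (ξ i) p := by
    have : FiniteDimensional ℂ (TangentSpace 𝓘(ℂ, E) (p : Z)) :=
      inferInstanceAs (FiniteDimensional ℂ E)
    refine exists_basis_eq_of_surjective (fun ξ ↦ inducedNormalSection E C ξ p) fun n ↦ ?_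
    obtain ⟨v, rfl⟩ := Submodule.Quotient.mk_surjective _ n
    obtain ⟨ξ, hξ⟩ := inducedVectorField_surjective (EG := EG) (G := G) (p : Z) v
    exact ⟨ξ, congrArg Submodule.Quotient.mk hξ⟩
  refine ⟨fun p ↦ ?_, hsec, hbasis⟩
  obtain ⟨r, ξ, b, hb⟩ := hbasis p
  exact ⟨r, fun i ↦ ⟨inducedNormalSection E C (ξ i), (hsec (ξ i)).2⟩, b, hb⟩
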